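/- Let $(\phi_n)_{n\ge 0}$ be the Hermite functions on $\mathbb{R}$, \[ \phi_n(x) = (-1)^n \left(2^n n!\sqrt{\pi}\right)^{-1/2} e^{x^2/2}\,\frac{d^n}{dx^n}e^{-x^2}. \] Let $s>\tfrac12$, let $(\gamma_j)_{j\ge 0}$ be a sequence of real numbers with $\gamma_j = O(j^{-s})$ as $j\to\infty$, and let $(\xi_j)_{j\ge 0}$ be i.i.d. random variables with law $\mathcal{N}(0,1)$ on a probability space. For $\beta>0$ let $C^{0,\beta}(\mathbb{R})$ be the space of bounded $\beta$-Hölder continuous functions $f:\mathbb{R}\to\mathbb{R}$, with norm \[ \|f\|_{C^{0,\beta}} = \sup_{x\in\mathbb{R}}|f(x)| + \sup_{x\neq y}\frac{|f(x)-f(y)|}{|x-y|^{\beta}} . \] Then, for every $\beta$ with $0<\beta<\frac{4s-2}{4s+1}$, almost surely the series $\sum_{j=0}^{\infty}\xi_j\gamma_j\phi_j$ converges in $C^{0,\beta}(\mathbb{R})$: its partial sums belong to $C^{0,\beta}(\mathbb{R})$ and converge in the norm above to a function in $C^{0,\beta}(\mathbb{R})$. In particular, almost surely its sum is $\beta$-Hölder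 continuous on $\mathbb{R}$. -/

import Mathlib

open MeasureTheory ProbabilityTheory Filter Topology
open scoped NNReal ENNReal Nat

/-- The `n`-th (normalised) Hermite function
`φₙ(x) = (-1)ⁿ (2ⁿ n! √π)^(-1/2) exp(x²/2) (dⁿ/dxⁿ) exp(-x²)`. -/
noncomputable def hermiteFun (n : ℕ) (x : ℝ) : ℝ :=
  (-1) ^ n * ((2 : ℝ) ^ n * (n ! : ℝ) * √Real.pi) ^ (-(1 / 2) : ℝ) *
    Real.exp (x ^ 2 / 2) * iteratedDeriv n (fun t : ℝ => Real.exp (-t ^ 2)) x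

/-- The norm of the Hölder space `C^{0,β}(ℝ)`: the supremum norm plus the `β`-Hölder seminorm
`sup_{x ≠ y} |f x - f y| / |x - y|^β`, as an extended nonnegative number
(equal to `∞` when `f` is not in `C^{0,β}(ℝ)`). -/
noncomputable def eC0HolderNorm (β : ℝ≥0) (f : ℝ → ℝ) : ℝ≥0∞ :=
  (⨆ x : ℝ, ‖f x‖ₑ) + eHolderNorm β f

/-- The space `C^{0,β}(ℝ)` (for `β > 0`) of bounded, globally `β`-Hölder functions on `ℝ`. -/
def C0Holder (β : ℝ≥0) : Set (ℝ → ℝ) := {f | eC0HolderNorm β f < ∞}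

/-- The sequence `F` of functions converges in (the norm of) `C^{0,β}(ℝ)`. -/
def ConvergesInC0Holder (β : ℝ≥0) (F : ℕ → ℝ → ℝ) : Prop :=
  (∀ N, F N ∈ C0Holder β) ∧
    ∃ u ∈ C0Holder β, Tendsto (fun N => eC0HolderNorm β (fun x => F N x - u x)) atTop (𝓝 0)

/-!
The series is split into the blocks `4ᵏ ≤ j < 4ᵏ⁺¹`, in which the Hermite functions `φⱼ` oscillate
at frequency about `l = 2ᵏ`, so that each derivative costs a factor `l`.

**Variance.** The random variable `∑ ξⱼ γⱼ φⱼ(x)` over a block is a centred Gaussian whose variance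
is at most `C l^{-4s}` times the spectral function `Kₙ(x) = ∑_{j < n} φⱼ(x)²`, with `n` of order
`l²`. No pointwise estimate on a single Hermite function is needed: the derivative of `Kₙ` telescopes
to `-√(2n) φₙ₋₁ φₙ` (`hasDerivAt_spectralFun_succ`), and as `φₙ₋₁`, `φₙ` have unit `L²` norm,
integration from `-∞` gives `Kₙ ≤ √(2n)` (`spectralFun_le`), while `∫ Kₙ = n`. Derivatives are handled by
the ladder relation `φⱼ' = √(j/2) φⱼ₋₁ - √((j+1)/2) φⱼ₊₁`, which bounds the variances of the rescaled
derivatives by the same spectral function (`sum_sq_hermiteDeriv_le`).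

**Moments.** By Tonelli and the Gaussian moment formula, the expectation of
`∑_{i ≤ 2} ∫ |l^{-i} f⁽ⁱ⁾|¹⁶` over a block sum `f` is at most a constant times
`∫ (l^{-4s} Kₙ)⁸ ≤ l^{-32s} (√(2n))⁷ n`, of order `l^{9 - 32s}` (`lintegral_blockEnergy_le`).

**Sup and Hölder norms.** The one-dimensional Sobolev inequality `enorm_pow_le_lintegral` bounds the
sixteenth powers of the sup norms of `f` and `f' / l` by `l` times this quantity, and interpolation
between them (`HolderBound.of_deriv_le`) bounds the `β`-Hölder norm at the cost of a factor `l^β`.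

**Summation.** A block has about `l²` partial sums, and the exponent `16` is so large that a union
bound over all of them is affordable: when `β < 2s - 1`, which follows from
`β < (4s - 2) / (4s + 1)`, the weighted sum of all energies over all partial sums of all blocks has
finite expectation (`ae_totalEnergy_lt_top`). Almost surely it is then finite, so that
the partial sums move by `O(rᵏ)`, with `r < 1`, during the `k`-th block (`holderBound_block`), and
such a sequence converges (`convergesInC0Holder_of_geometric`).
-/

/-! ### Hermite functions: recurrences and decay -/

theorem derivative_hermite_succ (n : ℕ) :
    Polynomial.derivative (Polynomial.hermite (n + 1)) =
      ((n : Polynomial ℤ) + 1) * Polynomial.hermite n := by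
  induction n with
  | zero => simp
  | succ n ih =>
    rw [Polynomial.hermite_succ (n + 1), Polynomial.derivative_sub, Polynomial.derivative_mul, ih]
    have h : Polynomial.derivative (((n : Polynomial ℤ) + 1) * Polynomial.hermite n)
        = ((n : Polynomial ℤ) + 1) * Polynomial.derivative (Polynomial.hermite n) := by
      rw [Polynomial.derivative_mul]
      simp
    rw [h, Polynomial.derivative_X, Polynomial.hermite_succ n]
    push_cast
    ring

/-- The function `hermiteFun n` in terms of the probabilists' Hermite polynomial. -/
theorem hermiteFun_eq (n : ℕ) (x : ℝ) :
    hermiteFun n x = (√((n ! : ℝ) * √Real.pi))⁻¹ *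
      (Polynomial.aeval (√2 * x) (Polynomial.hermite n) * Real.exp (-(x ^ 2 / 2))) := by
  have h2 : (√2 : ℝ) ^ 2 = 2 := Real.sq_sqrt (by norm_num)
  have hg : (fun t : ℝ => Real.exp (-t ^ 2)) =
      fun t : ℝ => (fun y : ℝ => Real.exp (-(y ^ 2 / 2))) (√2 * t) := by
    funext t
    simp only [mul_pow, h2]
    congr 1
    ring
  have hc : ContDiff ℝ n (fun y : ℝ => Real.exp (-(y ^ 2 / 2))) := by fun_prop
  have hpi : 0 < √Real.pi := Real.sqrt_pos.2 Real.pi_pos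
  have hpow : ((2 : ℝ) ^ n * (n ! : ℝ) * √Real.pi) ^ (-(1 / 2) : ℝ) =
      ((√2 : ℝ) ^ n)⁻¹ * (√((n ! : ℝ) * √Real.pi))⁻¹ := by
    rw [Real.rpow_neg (by positivity), ← Real.sqrt_eq_rpow, mul_assoc,
      Real.sqrt_mul (by positivity), mul_inv]
    congr 2
    rw [Real.sqrt_eq_iff_mul_self_eq (by positivity) (by positivity), ← mul_pow, ← sq, h2]
  have hexp : Real.exp (x ^ 2 / 2) * Real.exp (-(x ^ 2)) = Real.exp (-(x ^ 2 / 2)) := by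
    rw [← Real.exp_add]
    congr 1
    ring
  have hsq : (√2 * x) ^ 2 / 2 = x ^ 2 := by
    rw [mul_pow, h2]
    ring
  have h2n : (√2 : ℝ) ^ n ≠ 0 := by positivity
  unfold hermiteFun
  rw [hg, iteratedDeriv_comp_const_mul hc]
  simp only [iteratedDeriv_eq_iterate, Polynomial.deriv_gaussian_eq_hermite_mul_gaussian, hsq, hpow]
  rw [← hexp]
  field_simp
  rw [← pow_mul, mul_comm n 2, pow_mul]
  simp

theorem hermiteFun_continuous (n : ℕ) : Continuous (hermiteFun n) := by
  rw [funext (hermiteFun_eq n)]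
  have := (Polynomial.hermite n).continuous_aeval (A := ℝ)
  fun_prop

theorem sqrt_factorial_succ_mul (n : ℕ) :
    √(((n + 1)! : ℝ) * √Real.pi) = √((n + 1 : ℕ) : ℝ) * √((n ! : ℝ) * √Real.pi) := by
  rw [← Real.sqrt_mul (by positivity), Nat.factorial_succ]
  push_cast
  ring_nf

/-- The lowering relation `φₙ' = √(2n) φₙ₋₁ - x φₙ`; for `n = 0` the factor `√0` kills the
first term. -/
theorem hasDerivAt_hermiteFun (n : ℕ) (x : ℝ) :
    HasDerivAt (hermiteFun n) (√(2 * n) * hermiteFun (n - 1) x - x * hermiteFun n x) x := by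
  have h1 : HasDerivAt (fun x : ℝ => Polynomial.aeval (√2 * x) (Polynomial.hermite n))
      (Polynomial.aeval (√2 * x) (Polynomial.derivative (Polynomial.hermite n)) * √2) x := by
    have := ((Polynomial.hermite n).hasDerivAt_aeval (√2 * x))
    have h2 : HasDerivAt (fun x : ℝ => √2 * x) (√2) x := by
      simpa using (hasDerivAt_id x).const_mul (√2)
    exact this.comp x h2
  have h2 : HasDerivAt (fun x : ℝ => Real.exp (-(x ^ 2 / 2)))
      (Real.exp (-(x ^ 2 / 2)) * (-x)) x := by
    have : HasDerivAt (fun x : ℝ => -(x ^ 2 / 2)) (-x) x :=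
      ((hasDerivAt_pow 2 x).div_const 2).neg.congr_deriv (by simp)
    exact this.exp
  have h3 := (h1.mul h2).const_mul (√((n ! : ℝ) * √Real.pi))⁻¹
  refine (h3.congr_of_eventuallyEq (Eventually.of_forall (hermiteFun_eq n))).congr_deriv ?_
  rcases n with _ | n
  · simp [hermiteFun_eq]
    ring
  · have hpos : 0 < √((n + 1 : ℕ) : ℝ) := Real.sqrt_pos.2 (by positivity)
    have hpos2 : 0 < √((n ! : ℝ) * √Real.pi) :=
      Real.sqrt_pos.2 (mul_pos (by positivity) (Real.sqrt_pos.2 Real.pi_pos))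
    have hn' : (n : ℝ) + 1 = √((n + 1 : ℕ) : ℝ) ^ 2 := by
      rw [Real.sq_sqrt (by positivity)]; push_cast; rfl
    simp only [derivative_hermite_succ, hermiteFun_eq, sqrt_factorial_succ_mul,
      Nat.add_sub_cancel, map_mul, map_add, map_natCast, map_one]
    rw [hn', Real.sqrt_mul (show (0 : ℝ) ≤ 2 by norm_num)]
    field_simp
    ring

/-- The raising relation `√(2(n+1)) φₙ₊₁ = x φₙ - φₙ'`, with `φₙ'` replaced by its value in
`hasDerivAt_hermiteFun`. -/
theorem sqrt_mul_hermiteFun_succ (n : ℕ) (x : ℝ) :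
    √(2 * (n + 1 : ℕ)) * hermiteFun (n + 1) x =
      2 * (x * hermiteFun n x) - √(2 * n) * hermiteFun (n - 1) x := by
  have h2 : (√2 : ℝ) ^ 2 = 2 := Real.sq_sqrt (by norm_num)
  have hpos (n : ℕ) : 0 < √((n + 1 : ℕ) : ℝ) := Real.sqrt_pos.2 (by positivity)
  have hpos2 (n : ℕ) : 0 < √((n ! : ℝ) * √Real.pi) :=
    Real.sqrt_pos.2 (mul_pos (by positivity) (Real.sqrt_pos.2 Real.pi_pos))
  have h0 := hpos n
  have h1 := hpos2 n
  simp only [hermiteFun_eq, sqrt_factorial_succ_mul]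
  rcases n with _ | n
  · have h3 := hpos2 0
    simp at h3 ⊢
    field_simp
    linear_combination x * h2
  · have hn' : (n : ℝ) + 1 = √((n + 1 : ℕ) : ℝ) ^ 2 := by
      rw [Real.sq_sqrt (by positivity)]; push_cast; rfl
    have h3 := hpos n
    have h4 := hpos2 n
    have h6 : Polynomial.hermite (n + 1 + 1) = Polynomial.X * Polynomial.hermite (n + 1) -
        ((n : Polynomial ℤ) + 1) * Polynomial.hermite n := by
      rw [Polynomial.hermite_succ (n + 1), derivative_hermite_succ]
    have h7 : (0 : ℝ) ≤ 2 := by norm_num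
    rw [Real.sqrt_mul h7, Real.sqrt_mul h7, h6, sqrt_factorial_succ_mul]
    simp only [Nat.add_sub_cancel, map_sub, map_mul, map_add, map_natCast, map_one,
      Polynomial.aeval_X]
    rw [hn']
    field_simp
    linear_combination (x * Polynomial.aeval (√2 * x) (Polynomial.hermite (n + 1))) * h2

/-- Every polynomial is dominated by the Gaussian `exp (x² / 4)`. -/
theorem exists_abs_aeval_le (p : Polynomial ℤ) (c : ℝ) :
    ∃ C, 0 ≤ C ∧ ∀ x : ℝ, |Polynomial.aeval (c * x) p| ≤ C * Real.exp (x ^ 2 / 4) := by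
  induction p using Polynomial.induction_on' with
  | add p q hp hq =>
    obtain ⟨C, hC, h⟩ := hp
    obtain ⟨D, hD, h'⟩ := hq
    refine ⟨C + D, by positivity, fun x => ?_⟩
    rw [map_add, add_mul]
    exact (abs_add_le _ _).trans (add_le_add (h x) (h' x))
  | monomial n a =>
    refine ⟨|(a : ℝ)| * |c| ^ n * (1 + 4 ^ n * n !), by positivity, fun x => ?_⟩
    rw [Polynomial.aeval_monomial]
    simp only [algebraMap_int_eq, eq_intCast, abs_mul, abs_pow, mul_pow]
    -- `|x|ⁿ ≤ 1 + x²ⁿ`, and `(x²/4)ⁿ / n!` is a term of the exponential series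
    have h1 : |x| ^ n ≤ 1 + (x ^ 2) ^ n := by
      rw [← sq_abs x, ← pow_mul, mul_comm 2 n, pow_mul]
      nlinarith [sq_nonneg (|x| ^ n - 1), pow_nonneg (abs_nonneg x) n]
    have h2 : (x ^ 2 / 4) ^ n / n ! ≤ Real.exp (x ^ 2 / 4) :=
      Real.pow_div_factorial_le_exp _ (by positivity) n
    have h3 : 1 ≤ Real.exp (x ^ 2 / 4) := Real.one_le_exp (by positivity)
    have h4 : (x ^ 2) ^ n ≤ 4 ^ n * n ! * Real.exp (x ^ 2 / 4) := by
      rw [div_pow, div_div, div_le_iff₀ (by positivity)] at h2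
      linarith
    have h5 : |x| ^ n ≤ (1 + 4 ^ n * n !) * Real.exp (x ^ 2 / 4) := by
      rw [add_mul, one_mul]
      linarith
    calc |(a : ℝ)| * (|c| ^ n * |x| ^ n) = |(a : ℝ)| * |c| ^ n * |x| ^ n := by ring
      _ ≤ |(a : ℝ)| * |c| ^ n * ((1 + 4 ^ n * n !) * Real.exp (x ^ 2 / 4)) := by gcongr
      _ = _ := by ring

theorem exists_abs_hermiteFun_le (n : ℕ) :
    ∃ C, 0 ≤ C ∧ ∀ x : ℝ, |hermiteFun n x| ≤ C * Real.exp (-(x ^ 2 / 4)) := by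
  obtain ⟨C, hC, h⟩ := exists_abs_aeval_le (Polynomial.hermite n) (√2)
  refine ⟨(√((n ! : ℝ) * √Real.pi))⁻¹ * C, by positivity, fun x => ?_⟩
  rw [hermiteFun_eq, abs_mul, abs_of_nonneg (by positivity), abs_mul, Real.abs_exp, mul_assoc]
  refine mul_le_mul_of_nonneg_left ?_ (by positivity)
  calc _ ≤ C * Real.exp (x ^ 2 / 4) * Real.exp (-(x ^ 2 / 2)) := by gcongr; exact h x
    _ = _ := by
      rw [mul_assoc, ← Real.exp_add]
      congr 2
      ring

/-! ### Gaussian decay and the spectral function -/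

/-- Continuous functions on the line bounded by a multiple of `exp (-x² / 4)`. -/
def GaussianDecay (f : ℝ → ℝ) : Prop :=
  Continuous f ∧ ∃ C, 0 ≤ C ∧ ∀ x, |f x| ≤ C * Real.exp (-(x ^ 2 / 4))

namespace GaussianDecay

variable {f g : ℝ → ℝ}

theorem add (hf : GaussianDecay f) (hg : GaussianDecay g) : GaussianDecay (fun x => f x + g x) := by
  obtain ⟨hf, C, hC, h⟩ := hf
  obtain ⟨hg, D, hD, h'⟩ := hg
  refine ⟨hf.add hg, C + D, by positivity, fun x => ?_⟩
  rw [add_mul]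
  exact (abs_add_le _ _).trans (add_le_add (h x) (h' x))

theorem const_mul (c : ℝ) (hf : GaussianDecay f) : GaussianDecay (fun x => c * f x) := by
  obtain ⟨hf, C, hC, h⟩ := hf
  refine ⟨hf.const_mul c, |c| * C, by positivity, fun x => ?_⟩
  rw [abs_mul, mul_assoc]
  exact mul_le_mul_of_nonneg_left (h x) (abs_nonneg c)

theorem sub (hf : GaussianDecay f) (hg : GaussianDecay g) : GaussianDecay (fun x => f x - g x) := by
  have := hf.add (hg.const_mul (-1))
  simpa [sub_eq_add_neg] using this

theorem sum {ι : Type*} (s : Finset ι) {F : ι → ℝ → ℝ} (hF : ∀ i, GaussianDecay (F i)) :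
    GaussianDecay (fun x => ∑ i ∈ s, F i x) := by
  classical
  induction s using Finset.induction_on with
  | empty => exact ⟨by simpa using continuous_const, 0, le_rfl, by simp⟩
  | insert a s ha ih => simpa [Finset.sum_insert ha] using (hF a).add ih

theorem mul (hf : GaussianDecay f) (hg : GaussianDecay g) : GaussianDecay (fun x => f x * g x) := by
  obtain ⟨hf, C, hC, h⟩ := hf
  obtain ⟨hg, D, hD, h'⟩ := hg
  refine ⟨hf.mul hg, C * D, by positivity, fun x => ?_⟩
  have h1 : Real.exp (-(x ^ 2 / 4)) ≤ 1 := Real.exp_le_one_iff.2 (by nlinarith [sq_nonneg x])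
  calc |f x * g x| = |f x| * |g x| := abs_mul _ _
    _ ≤ (C * Real.exp (-(x ^ 2 / 4))) * (D * Real.exp (-(x ^ 2 / 4))) := by
      gcongr
      · exact h x
      · exact h' x
    _ ≤ (C * Real.exp (-(x ^ 2 / 4))) * (D * 1) := by gcongr
    _ = _ := by ring

theorem integrable (hf : GaussianDecay f) : Integrable f := by
  obtain ⟨hf, C, hC, h⟩ := hf
  have h1 : Integrable (fun x : ℝ => C * Real.exp (-(1 / 4) * x ^ 2)) :=
    (integrable_exp_neg_mul_sq (by norm_num)).const_mul C
  refine h1.mono' hf.aestronglyMeasurable (Eventually.of_forall fun x => ?_)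
  rw [show -(1 / 4) * x ^ 2 = -(x ^ 2 / 4) by ring]
  exact h x

theorem exists_bound (hf : GaussianDecay f) : ∃ C, 0 ≤ C ∧ ∀ x, |f x| ≤ C := by
  obtain ⟨hf, C, hC, h⟩ := hf
  refine ⟨C, hC, fun x => (h x).trans ?_⟩
  have h1 : Real.exp (-(x ^ 2 / 4)) ≤ 1 := Real.exp_le_one_iff.2 (by nlinarith [sq_nonneg x])
  nlinarith

end GaussianDecay

theorem gaussianDecay_hermiteFun (n : ℕ) : GaussianDecay (hermiteFun n) :=
  ⟨hermiteFun_continuous n, exists_abs_hermiteFun_le n⟩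

/-- The derivative of the product of two consecutive Hermite functions is a multiple of
`φₙ² - φₙ₊₁²`. -/
theorem hasDerivAt_hermiteFun_mul_succ (n : ℕ) (x : ℝ) :
    HasDerivAt (fun x => hermiteFun n x * hermiteFun (n + 1) x)
      (√(2 * (n + 1 : ℕ)) * (hermiteFun n x ^ 2 - hermiteFun (n + 1) x ^ 2)) x := by
  refine ((hasDerivAt_hermiteFun n x).mul (hasDerivAt_hermiteFun (n + 1) x)).congr_deriv ?_
  have h := sqrt_mul_hermiteFun_succ n x
  simp only [Nat.add_sub_cancel]
  linear_combination hermiteFun (n + 1) x * h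

theorem integrable_hermiteFun_sq (n : ℕ) : Integrable (fun x => hermiteFun n x ^ 2) := by
  simpa [sq] using ((gaussianDecay_hermiteFun n).mul (gaussianDecay_hermiteFun n)).integrable

theorem integral_hermiteFun_sq (n : ℕ) : ∫ x, hermiteFun n x ^ 2 = 1 := by
  induction n with
  | zero =>
    have hpi : 0 < √Real.pi := Real.sqrt_pos.2 Real.pi_pos
    have h (x : ℝ) : hermiteFun 0 x ^ 2 = (√Real.pi)⁻¹ * Real.exp (-1 * x ^ 2) := by
      rw [hermiteFun_eq]
      simp only [Polynomial.hermite_zero, map_one, one_mul, mul_pow, ← Real.exp_nat_mul, inv_pow,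
        Nat.factorial_zero, Nat.cast_one]
      rw [Real.sq_sqrt hpi.le]
      congr 2
      push_cast
      ring
    simp_rw [h]
    rw [integral_const_mul, integral_gaussian, div_one, inv_mul_cancel₀ hpi.ne']
  | succ n ih =>
    have h := integral_eq_zero_of_hasDerivAt_of_integrable (hasDerivAt_hermiteFun_mul_succ n)
      (((integrable_hermiteFun_sq n).sub (integrable_hermiteFun_sq (n + 1))).const_mul _)
      ((gaussianDecay_hermiteFun n).mul (gaussianDecay_hermiteFun (n + 1))).integrable
    rw [integral_const_mul, integral_sub (integrable_hermiteFun_sq n)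
      (integrable_hermiteFun_sq (n + 1)), ih] at h
    have h2 : 0 < √(2 * (n + 1 : ℕ) : ℝ) := Real.sqrt_pos.2 (by positivity)
    rcases mul_eq_zero.1 h with h | h
    · exact absurd h h2.ne'
    · linarith

/-- The spectral function of the harmonic oscillator: the diagonal `∑_{j < n} φⱼ(x)²` of the
kernel of the orthogonal projection onto the first `n` Hermite functions. -/
noncomputable def spectralFun (n : ℕ) (x : ℝ) : ℝ := ∑ j ∈ Finset.range n, hermiteFun j x ^ 2

theorem spectralFun_nonneg (n : ℕ) (x : ℝ) : 0 ≤ spectralFun n x :=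
  Finset.sum_nonneg fun _ _ => sq_nonneg _

theorem spectralFun_mono {m n : ℕ} (h : m ≤ n) (x : ℝ) : spectralFun m x ≤ spectralFun n x :=
  Finset.sum_le_sum_of_subset_of_nonneg (Finset.range_mono h) fun _ _ _ => sq_nonneg _

theorem integrable_spectralFun (n : ℕ) : Integrable (spectralFun n) :=
  integrable_finsetSum _ fun j _ => integrable_hermiteFun_sq j

theorem integral_spectralFun (n : ℕ) : ∫ x, spectralFun n x = n := by
  unfold spectralFun
  rw [integral_finsetSum _ fun j _ => integrable_hermiteFun_sq j]
  simp [integral_hermiteFun_sq]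

/-- The differentiated Christoffel–Darboux formula on the diagonal: the sum telescopes. -/
theorem hasDerivAt_spectralFun_succ (n : ℕ) (x : ℝ) :
    HasDerivAt (spectralFun (n + 1))
      (-(√(2 * (n + 1 : ℕ)) * (hermiteFun n x * hermiteFun (n + 1) x))) x := by
  have hd (n : ℕ) : HasDerivAt (fun x => hermiteFun n x ^ 2)
      (2 * hermiteFun n x * (√(2 * n) * hermiteFun (n - 1) x - x * hermiteFun n x)) x :=
    ((hasDerivAt_hermiteFun n x).pow 2).congr_deriv (by simp)
  induction n with
  | zero =>
    have h := sqrt_mul_hermiteFun_succ 0 x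
    refine ((hd 0).congr_of_eventuallyEq
      (Eventually.of_forall fun x => by simp [spectralFun])).congr_deriv ?_
    simp at h ⊢
    linear_combination -hermiteFun 0 x * h
  | succ n ih =>
    refine ((ih.add (hd (n + 1))).congr_of_eventuallyEq
      (Eventually.of_forall fun x => by simp [spectralFun, Finset.sum_range_succ])).congr_deriv ?_
    have h := sqrt_mul_hermiteFun_succ (n + 1) x
    simp only [Nat.add_sub_cancel] at h ⊢
    linear_combination hermiteFun (n + 1) x * h

/-- The derivative of the spectral function is a product of two functions of unit `L²` norm, up to
the factor `√(2n)`, so integrating it from `-∞` bounds the spectral function uniformly. -/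
theorem spectralFun_le (n : ℕ) (x : ℝ) : spectralFun n x ≤ √(2 * n) := by
  rcases n with _ | n
  · simp [spectralFun]
  set c := √(2 * (n + 1 : ℕ) : ℝ) with hc
  have hc0 : 0 ≤ c := Real.sqrt_nonneg _
  have hi : Integrable (fun x => hermiteFun n x * hermiteFun (n + 1) x) :=
    ((gaussianDecay_hermiteFun n).mul (gaussianDecay_hermiteFun (n + 1))).integrable
  have hi' : Integrable (fun x => -(c * (hermiteFun n x * hermiteFun (n + 1) x))) :=
    (hi.const_mul c).neg
  have hlim : Tendsto (spectralFun (n + 1)) atBot (𝓝 0) :=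
    tendsto_zero_of_hasDerivAt_of_integrableOn_Iic (a := 0)
      (fun x _ => hasDerivAt_spectralFun_succ n x) hi'.integrableOn
      (integrable_spectralFun _).integrableOn
  have hftc := integral_Iic_of_hasDerivAt_of_tendsto' (a := x)
    (fun y _ => hasDerivAt_spectralFun_succ n y) hi'.integrableOn hlim
  have hb : Integrable (fun x => c * ((hermiteFun n x ^ 2 + hermiteFun (n + 1) x ^ 2) / 2)) :=
    (((integrable_hermiteFun_sq n).add (integrable_hermiteFun_sq (n + 1))).div_const 2).const_mul c
  rw [sub_zero] at hftc
  rw [← hftc]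
  calc ∫ y in Set.Iic x, -(c * (hermiteFun n y * hermiteFun (n + 1) y))
      ≤ ∫ y in Set.Iic x, c * ((hermiteFun n y ^ 2 + hermiteFun (n + 1) y ^ 2) / 2) := by
        refine setIntegral_mono hi'.integrableOn hb.integrableOn fun y => ?_
        rw [← mul_neg]
        refine mul_le_mul_of_nonneg_left ?_ hc0
        nlinarith [sq_nonneg (hermiteFun n y + hermiteFun (n + 1) y)]
    _ ≤ ∫ y, c * ((hermiteFun n y ^ 2 + hermiteFun (n + 1) y ^ 2) / 2) :=
        setIntegral_le_integral hb (Eventually.of_forall fun y => by positivity)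
    _ = c := by
        rw [integral_const_mul, integral_div,
          integral_add (integrable_hermiteFun_sq n) (integrable_hermiteFun_sq (n + 1)),
          integral_hermiteFun_sq, integral_hermiteFun_sq]
        norm_num

/-! ### Derivatives of Hermite functions -/

/-- The ladder form of differentiation in the Hermite basis:
`(L a)ⱼ = √(j/2) aⱼ₋₁ - √((j+1)/2) aⱼ₊₁`; for `j = 0` the first term vanishes. -/
noncomputable def ladder (a : ℕ → ℝ) (j : ℕ) : ℝ :=
  √((j : ℝ) / 2) * a (j - 1) - √(((j : ℝ) + 1) / 2) * a (j + 1)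

theorem sum_range_ladder_sq_le (a : ℕ → ℝ) (n : ℕ) :
    ∑ j ∈ Finset.range n, ladder a j ^ 2 ≤ 2 * n * ∑ j ∈ Finset.range (n + 1), a j ^ 2 := by
  have h1 (j : ℕ) : ladder a j ^ 2 ≤ (j : ℝ) * a (j - 1) ^ 2 + ((j : ℝ) + 1) * a (j + 1) ^ 2 := by
    have e1 : √((j : ℝ) / 2) ^ 2 = j / 2 := Real.sq_sqrt (by positivity)
    have e2 : √(((j : ℝ) + 1) / 2) ^ 2 = (j + 1) / 2 := Real.sq_sqrt (by positivity)
    have h3 := sq_nonneg (√((j : ℝ) / 2) * a (j - 1) + √(((j : ℝ) + 1) / 2) * a (j + 1))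
    unfold ladder
    calc _ ≤ 2 * (√((j : ℝ) / 2) ^ 2 * a (j - 1) ^ 2) +
          2 * (√(((j : ℝ) + 1) / 2) ^ 2 * a (j + 1) ^ 2) := by linarith
      _ = _ := by rw [e1, e2]; ring
  have h2 : ∑ j ∈ Finset.range n, (j : ℝ) * a (j - 1) ^ 2 ≤
      n * ∑ j ∈ Finset.range (n + 1), a j ^ 2 := by
    rcases n with _ | n
    · simp
    rw [Finset.sum_range_succ']
    simp only [Nat.cast_zero, zero_mul, add_zero, Nat.add_sub_cancel]
    calc ∑ j ∈ Finset.range n, ((j + 1 : ℕ) : ℝ) * a j ^ 2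
        ≤ ∑ j ∈ Finset.range n, ((n + 1 : ℕ) : ℝ) * a j ^ 2 := by
          refine Finset.sum_le_sum fun j hj => mul_le_mul_of_nonneg_right ?_ (sq_nonneg _)
          have := Finset.mem_range.1 hj
          exact_mod_cast (by omega : j + 1 ≤ n + 1)
      _ = ((n + 1 : ℕ) : ℝ) * ∑ j ∈ Finset.range n, a j ^ 2 := by rw [Finset.mul_sum]
      _ ≤ _ := mul_le_mul_of_nonneg_left (Finset.sum_le_sum_of_subset_of_nonneg
          (Finset.range_mono (by omega)) fun _ _ _ => sq_nonneg _) (by positivity)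
  have h3 : ∑ j ∈ Finset.range n, ((j : ℝ) + 1) * a (j + 1) ^ 2 ≤
      n * ∑ j ∈ Finset.range (n + 1), a j ^ 2 := by
    rw [Finset.sum_range_succ', mul_add, Finset.mul_sum]
    refine (Finset.sum_le_sum fun j hj => mul_le_mul_of_nonneg_right ?_ (sq_nonneg _)).trans
      (le_add_of_nonneg_right (by positivity))
    have := Finset.mem_range.1 hj
    exact_mod_cast (by omega : j + 1 ≤ n)
  calc _ ≤ ∑ j ∈ Finset.range n, ((j : ℝ) * a (j - 1) ^ 2 + ((j : ℝ) + 1) * a (j + 1) ^ 2) :=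
        Finset.sum_le_sum fun j _ => h1 j
    _ ≤ _ := by
      rw [Finset.sum_add_distrib]
      linarith

/-- The `i`-th derivative of the `j`-th Hermite function at `x`, as an iterate of the ladder. -/
noncomputable def hermiteDeriv (i j : ℕ) (x : ℝ) : ℝ := ladder^[i] (fun j => hermiteFun j x) j

theorem hermiteDeriv_zero (j : ℕ) (x : ℝ) : hermiteDeriv 0 j x = hermiteFun j x := rfl

theorem hermiteDeriv_succ (i j : ℕ) (x : ℝ) :
    hermiteDeriv (i + 1) j x = ladder (fun j => hermiteDeriv i j x) j := by
  unfold hermiteDeriv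
  rw [Function.iterate_succ_apply']

theorem hasDerivAt_hermiteDeriv (i j : ℕ) (x : ℝ) :
    HasDerivAt (hermiteDeriv i j) (hermiteDeriv (i + 1) j x) x := by
  induction i generalizing j with
  | zero =>
    refine (hasDerivAt_hermiteFun j x).congr_deriv ?_
    rw [hermiteDeriv_succ]
    simp only [ladder, hermiteDeriv_zero]
    have h := sqrt_mul_hermiteFun_succ j x
    have e (t : ℝ) : √(2 * t) = 2 * √(t / 2) := by
      rw [show 2 * t = 2 ^ 2 * (t / 2) by ring, Real.sqrt_mul (by norm_num),
        Real.sqrt_sq (by norm_num)]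
    rw [e, e] at h
    rw [e]
    push_cast at h
    linear_combination h / 2
  | succ i ih =>
    rw [hermiteDeriv_succ]
    refine ((((ih (j - 1)).const_mul _).sub ((ih (j + 1)).const_mul _)).congr_of_eventuallyEq
      (Eventually.of_forall fun y => ?_))
    rw [hermiteDeriv_succ]
    rfl

theorem gaussianDecay_hermiteDeriv (i j : ℕ) : GaussianDecay (hermiteDeriv i j) := by
  induction i generalizing j with
  | zero => exact gaussianDecay_hermiteFun j
  | succ i ih =>
    rw [funext (hermiteDeriv_succ i j)]
    exact ((ih (j - 1)).const_mul _).sub ((ih (j + 1)).const_mul _)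

theorem sum_range_hermiteDeriv_sq_le (i n : ℕ) (x : ℝ) :
    ∑ j ∈ Finset.range n, hermiteDeriv i j x ^ 2 ≤ (2 * (n + i : ℕ)) ^ i * spectralFun (n + i) x := by
  induction i generalizing n with
  | zero => simp [spectralFun, hermiteDeriv_zero]
  | succ i ih =>
    simp only [hermiteDeriv_succ]
    refine (sum_range_ladder_sq_le (fun j => hermiteDeriv i j x) n).trans ?_
    have h := ih (n + 1)
    rw [show n + 1 + i = n + (i + 1) by ring] at h
    have h0 := spectralFun_nonneg (n + (i + 1)) x
    calc _ ≤ 2 * (n : ℝ) * ((2 * (n + (i + 1) : ℕ)) ^ i * spectralFun (n + (i + 1)) x) := by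
          gcongr
      _ ≤ 2 * ((n + (i + 1) : ℕ) : ℝ) *
          ((2 * (n + (i + 1) : ℕ)) ^ i * spectralFun (n + (i + 1)) x) := by
          gcongr
          omega
      _ = _ := by ring

/-! ### A one-dimensional Sobolev inequality -/

/-- The sup norm of a decaying function is controlled by the `L^p` norms, `p = 2q`, of the function
and of its derivative; the scale `l` balances the two. -/
theorem enorm_pow_le_lintegral {f f' : ℝ → ℝ} {q : ℕ} (hq : q ≠ 0) {l : ℝ} (hl : 0 < l)
    (hf : GaussianDecay f) (hf' : GaussianDecay f') (hd : ∀ x, HasDerivAt f (f' x) x) (x : ℝ) :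
    ‖f x‖ₑ ^ (2 * q) ≤ ENNReal.ofReal (2 * q * l) *
      ∫⁻ y, (‖f y‖ₑ ^ (2 * q) + ‖f' y / l‖ₑ ^ (2 * q)) := by
  have hpow {g : ℝ → ℝ} (hg : GaussianDecay g) (k : ℕ) : GaussianDecay (fun x => g x ^ (k + 1)) := by
    induction k with
    | zero => simpa using hg
    | succ k ih =>
      simp only [pow_succ _ (k + 1)]
      exact ih.mul hg
  obtain ⟨p, hp⟩ : ∃ p, 2 * q = p + 1 := ⟨2 * q - 1, by omega⟩
  have hp0 : p = (p - 1) + 1 := by omega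
  have hpe : Even (p + 1) := ⟨q, by omega⟩
  have hdp (y : ℝ) : HasDerivAt (fun x => f x ^ (p + 1)) ((p + 1) * (f y ^ p * f' y)) y :=
    ((hd y).pow (p + 1)).congr_deriv (by push_cast; ring)
  have hi1 : Integrable (fun y => (p + 1) * (f y ^ p * f' y)) := by
    rw [hp0]
    exact (((hpow hf (p - 1)).mul hf').const_mul _).integrable
  have hlim : Tendsto (fun x => f x ^ (p + 1)) atBot (𝓝 0) :=
    tendsto_zero_of_hasDerivAt_of_integrableOn_Iic (a := 0) (fun y _ => hdp y) hi1.integrableOn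
      (hpow hf p).integrable.integrableOn
  have hftc := integral_Iic_of_hasDerivAt_of_tendsto' (a := x) (fun y _ => hdp y)
    hi1.integrableOn hlim
  rw [sub_zero] at hftc
  -- for nonnegative `a` and `b`, compare `a` with `b / l`: the larger one controls the product
  have hyoung (a b : ℝ) : |a ^ p * b| ≤ l * (a ^ (p + 1) + (b / l) ^ (p + 1)) := by
    have h1 : |a ^ p * b| = l * (|a| ^ p * |b / l|) := by
      rw [abs_mul, abs_pow, abs_div, abs_of_pos hl]
      field_simp
    rw [h1, ← hpe.pow_abs a, ← hpe.pow_abs (b / l)]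
    refine mul_le_mul_of_nonneg_left ?_ hl.le
    have ha := abs_nonneg a
    have hb := abs_nonneg (b / l)
    rcases le_total (|b / l|) |a| with h | h
    · calc |a| ^ p * |b / l| ≤ |a| ^ p * |a| := by gcongr
        _ ≤ _ := by rw [← pow_succ]; exact le_add_of_nonneg_right (by positivity)
    · calc |a| ^ p * |b / l| ≤ |b / l| ^ p * |b / l| := by gcongr
        _ ≤ _ := by rw [← pow_succ]; exact le_add_of_nonneg_left (by positivity)
  have hpt (y : ℝ) : ‖(p + 1) * (f y ^ p * f' y)‖ₑ ≤ ENNReal.ofReal (2 * q * l) *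
      (‖f y‖ₑ ^ (2 * q) + ‖f' y / l‖ₑ ^ (2 * q)) := by
    have hq' : (2 * q : ℝ) = p + 1 := by exact_mod_cast hp
    rw [hp, hq', ← enorm_pow, ← enorm_pow, ← ofReal_norm, ← ofReal_norm, ← ofReal_norm,
      ← ENNReal.ofReal_add (norm_nonneg _) (norm_nonneg _),
      ← ENNReal.ofReal_mul (by positivity)]
    refine ENNReal.ofReal_le_ofReal ?_
    simp only [Real.norm_eq_abs]
    rw [abs_mul, abs_of_nonneg (by positivity : (0 : ℝ) ≤ p + 1), mul_assoc,
      abs_of_nonneg (hpe.pow_nonneg (f y)), abs_of_nonneg (hpe.pow_nonneg (f' y / l))]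
    exact mul_le_mul_of_nonneg_left (hyoung _ _) (by positivity)
  calc ‖f x‖ₑ ^ (2 * q) = ‖∫ y in Set.Iic x, (p + 1) * (f y ^ p * f' y)‖ₑ := by
        rw [hftc, hp, enorm_pow]
    _ ≤ ∫⁻ y in Set.Iic x, ‖(p + 1) * (f y ^ p * f' y)‖ₑ := enorm_integral_le_lintegral_enorm _
    _ ≤ ∫⁻ y, ‖(p + 1) * (f y ^ p * f' y)‖ₑ := setLIntegral_le_lintegral _ _
    _ ≤ ∫⁻ y, ENNReal.ofReal (2 * q * l) *
        (‖f y‖ₑ ^ (2 * q) + ‖f' y / l‖ₑ ^ (2 * q)) := lintegral_mono hpt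
    _ = _ := lintegral_const_mul' _ _ ENNReal.ofReal_ne_top

/-! ### Hölder bounds -/

/-- The constant `A` bounds both the sup norm and the `β`-Hölder seminorm of `f`. -/
def HolderBound (β : ℝ≥0) (f : ℝ → ℝ) (A : ℝ) : Prop :=
  (∀ x, |f x| ≤ A) ∧ ∀ x y, |f x - f y| ≤ A * |x - y| ^ (β : ℝ)

namespace HolderBound

variable {β : ℝ≥0} {f g : ℝ → ℝ} {A B : ℝ}

theorem nonneg (h : HolderBound β f A) : 0 ≤ A := (abs_nonneg _).trans (h.1 0)

theorem mono (h : HolderBound β f A) (hAB : A ≤ B) : HolderBound β f B :=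
  ⟨fun x => (h.1 x).trans hAB, fun x y => (h.2 x y).trans (by gcongr)⟩

theorem congr (h : HolderBound β f A) (hfg : ∀ x, g x = f x) : HolderBound β g A :=
  (funext hfg : g = f) ▸ h

theorem add (hf : HolderBound β f A) (hg : HolderBound β g B) :
    HolderBound β (fun x => f x + g x) (A + B) := by
  refine ⟨fun x => (abs_add_le _ _).trans (add_le_add (hf.1 x) (hg.1 x)), fun x y => ?_⟩
  rw [add_sub_add_comm, add_mul]
  exact (abs_add_le _ _).trans (add_le_add (hf.2 x y) (hg.2 x y))

theorem sub (hf : HolderBound β f A) (hg : HolderBound β g B) :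
    HolderBound β (fun x => f x - g x) (A + B) := by
  refine ⟨fun x => (abs_sub _ _).trans (add_le_add (hf.1 x) (hg.1 x)), fun x y => ?_⟩
  rw [sub_sub_sub_comm, add_mul]
  exact (abs_sub _ _).trans (add_le_add (hf.2 x y) (hg.2 x y))

theorem of_tendsto {F : ℕ → ℝ → ℝ} (hF : ∀ n, HolderBound β (F n) A)
    (hlim : ∀ x, Tendsto (fun n => F n x) atTop (𝓝 (f x))) : HolderBound β f A :=
  ⟨fun x => le_of_tendsto (hlim x).abs (Eventually.of_forall fun n => (hF n).1 x),
    fun x y => le_of_tendsto ((hlim x).sub (hlim y)).abs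
      (Eventually.of_forall fun n => (hF n).2 x y)⟩

theorem eC0HolderNorm_le (h : HolderBound β f A) :
    eC0HolderNorm β f ≤ ENNReal.ofReal (2 * A) := by
  have h1 : (⨆ x : ℝ, ‖f x‖ₑ) ≤ ENNReal.ofReal A := by
    refine iSup_le fun x => ?_
    rw [← ofReal_norm]
    exact ENNReal.ofReal_le_ofReal (h.1 x)
  have h2 : HolderWith A.toNNReal β f := by
    intro x y
    rw [edist_dist, edist_dist, Real.dist_eq, Real.dist_eq,
      ENNReal.ofReal_rpow_of_nonneg (abs_nonneg _) β.coe_nonneg]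
    change _ ≤ ENNReal.ofReal A * _
    rw [← ENNReal.ofReal_mul h.nonneg]
    exact ENNReal.ofReal_le_ofReal (h.2 x y)
  rw [two_mul, ENNReal.ofReal_add h.nonneg h.nonneg]
  exact add_le_add h1 h2.eHolderNorm_le

theorem mem_C0Holder (h : HolderBound β f A) : f ∈ C0Holder β :=
  h.eC0HolderNorm_le.trans_lt ENNReal.ofReal_lt_top

/-- Interpolation between sup norm and Lipschitz bounds. -/
theorem of_deriv_le {f' : ℝ → ℝ} {s l : ℝ} (hβ : β ≤ 1) (hl : 1 ≤ l)
    (hd : ∀ x, HasDerivAt f (f' x) x) (hf : ∀ x, |f x| ≤ s) (hf' : ∀ x, |f' x| ≤ l * s) :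
    HolderBound β f (2 * l ^ (β : ℝ) * s) := by
  have hs : 0 ≤ s := (abs_nonneg _).trans (hf 0)
  have h1 : 1 ≤ l ^ (β : ℝ) := Real.one_le_rpow hl β.2
  refine ⟨fun x => (hf x).trans (by nlinarith), fun x y => ?_⟩
  have hlip : |f x - f y| ≤ l * s * |x - y| :=
    Convex.norm_image_sub_le_of_norm_hasDerivWithin_le (f := f) (f' := f') (s := Set.univ)
      (fun z _ => (hd z).hasDerivWithinAt) (fun z _ => hf' z) convex_univ trivial trivial
  have h2 : |f x - f y| ≤ 2 * s := (abs_sub _ _).trans (by linarith [hf x, hf y])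
  have h3 : 2 * l ^ (β : ℝ) * s * |x - y| ^ (β : ℝ) = 2 * s * (l * |x - y|) ^ (β : ℝ) := by
    rw [Real.mul_rpow (by linarith) (abs_nonneg _)]
    ring
  rw [h3]
  have h4 : 0 ≤ l * |x - y| := mul_nonneg (by linarith) (abs_nonneg _)
  rcases le_total (l * |x - y|) 1 with h | h
  · have h5 : l * |x - y| ≤ (l * |x - y|) ^ (β : ℝ) := by
      have := Real.rpow_le_rpow_of_exponent_ge_of_imp h4 h (show (β : ℝ) ≤ 1 by exact_mod_cast hβ)
        (fun _ h => absurd h one_ne_zero)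
      rwa [Real.rpow_one] at this
    nlinarith
  · have h5 : 1 ≤ (l * |x - y|) ^ (β : ℝ) := Real.one_le_rpow h β.2
    nlinarith

end HolderBound

/-- A sequence of functions that moves by at most `C rᵏ` during the `k`-th block
`[4ᵏ, 4ᵏ⁺¹]` of indices converges. -/
theorem convergesInC0Holder_of_geometric {β : ℝ≥0} {F : ℕ → ℝ → ℝ} {C r : ℝ} (hr0 : 0 ≤ r)
    (hr1 : r < 1) (hF : ∀ N, ∃ A, HolderBound β (F N) A)
    (h : ∀ k N, 4 ^ k ≤ N → N ≤ 4 ^ (k + 1) →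
      HolderBound β (fun x => F N x - F (4 ^ k) x) (C * r ^ k)) :
    ConvergesInC0Holder β F := by
  have hr : 0 < 1 - r := by linarith
  have hC : 0 ≤ C := by simpa using (h 0 1 le_rfl (by norm_num)).nonneg
  have hstep (k : ℕ) : HolderBound β (fun x => F (4 ^ (k + 1)) x - F (4 ^ k) x) (C * r ^ k) :=
    h k _ (Nat.pow_le_pow_right (by norm_num) (by omega)) le_rfl
  have hblock (k j : ℕ) : HolderBound β (fun x => F (4 ^ (k + j)) x - F (4 ^ k) x)
      (C * (r ^ k - r ^ (k + j)) / (1 - r)) := by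
    induction j with
    | zero => exact ⟨by simp, by simp⟩
    | succ j ih =>
      refine ((ih.add (hstep (k + j))).mono (le_of_eq ?_)).congr fun x => ?_
      · field_simp
        ring
      · rw [← add_assoc]
        ring
  have hlim (x : ℝ) : ∃ y, Tendsto (fun k => F (4 ^ k) x) atTop (𝓝 y) := by
    refine cauchySeq_tendsto_of_complete (cauchySeq_of_le_geometric r C hr1 fun k => ?_)
    rw [dist_comm, Real.dist_eq]
    exact (hstep k).1 x
  choose u hu using hlim
  have htail (k : ℕ) : HolderBound β (fun x => u x - F (4 ^ k) x) (C * r ^ k / (1 - r)) := by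
    refine HolderBound.of_tendsto (F := fun j x => F (4 ^ (k + j)) x - F (4 ^ k) x)
      (fun j => (hblock k j).mono ?_) fun x => ?_
    · gcongr
      linarith [pow_nonneg hr0 (k + j)]
    · refine Tendsto.sub_const ?_ _
      simpa [add_comm] using (tendsto_add_atTop_iff_nat k).2 (hu x)
  have hconv (N : ℕ) (hN : N ≠ 0) : HolderBound β (fun x => F N x - u x)
      ((C + C / (1 - r)) * r ^ Nat.log 4 N) := by
    have h1 := h (Nat.log 4 N) N (Nat.pow_log_le_self 4 hN)
      (Nat.lt_pow_succ_log_self (by norm_num) N).le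
    exact ((h1.sub (htail (Nat.log 4 N))).mono (by rw [add_mul]; gcongr; rw [mul_div_right_comm])).congr
      fun x => by ring
  refine ⟨fun N => (hF N).choose_spec.mem_C0Holder, u, ?_, ?_⟩
  · obtain ⟨A, hA⟩ := hF 1
    exact ((hA.sub (hconv 1 one_ne_zero)).congr fun x => by ring).mem_C0Holder
  · have hlog : Tendsto (fun N => Nat.log 4 N) atTop atTop :=
      tendsto_atTop.2 fun b => (eventually_ge_atTop (4 ^ b)).mono fun N hN =>
        Nat.le_log_of_pow_le (by norm_num) hN
    have h0 : Tendsto (fun N => ENNReal.ofReal (2 * ((C + C / (1 - r)) * r ^ Nat.log 4 N)))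
        atTop (𝓝 0) := by
      have := ((((tendsto_pow_atTop_nhds_zero_of_lt_one hr0 hr1).comp hlog).const_mul
        (C + C / (1 - r))).const_mul 2)
      simpa using ENNReal.tendsto_ofReal this
    refine tendsto_of_tendsto_of_tendsto_of_le_of_le' tendsto_const_nhds h0
      (Eventually.of_forall fun _ => zero_le) ?_
    exact (eventually_ne_atTop 0).mono fun N hN => (hconv N hN).eC0HolderNorm_le

/-! ### Moments of Gaussian sums -/

/-- The absolute moment of order `2q` of the standard Gaussian law. -/
noncomputable def gaussianMoment (q : ℕ) : ℝ≥0∞ := ∫⁻ x : ℝ, ‖x‖ₑ ^ (2 * q) ∂gaussianReal 0 1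

theorem gaussianMoment_lt_top (q : ℕ) : gaussianMoment q < ∞ := by
  rcases Nat.eq_zero_or_pos q with rfl | hq
  · simp [gaussianMoment]
  have h := lintegral_rpow_enorm_lt_top_of_eLpNorm_lt_top (p := ((2 * q : ℕ) : ℝ≥0∞))
    (by simp; omega) (ENNReal.natCast_ne_top _)
    (memLp_id_gaussianReal' (μ := 0) (v := 1) _ (ENNReal.natCast_ne_top (2 * q))).2
  simpa only [ENNReal.toReal_natCast, ENNReal.rpow_natCast, id, gaussianMoment] using h

section GaussianSum

variable {Ω : Type*} [MeasurableSpace Ω] {P : Measure Ω} [IsProbabilityMeasure P]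
  {ξ : ℕ → Ω → ℝ}

theorem hasLaw_gaussian_sum (hlaw : ∀ j, HasLaw (ξ j) (gaussianReal 0 1) P)
    (hindep : iIndepFun ξ P) (a : ℕ → ℝ) (J : Finset ℕ) :
    HasLaw (fun ω => ∑ j ∈ J, ξ j ω * a j)
      (gaussianReal 0 (∑ j ∈ J, (a j ^ 2).toNNReal)) P := by
  have hl (j : ℕ) : HasLaw (fun ω => ξ j ω * a j) (gaussianReal 0 (a j ^ 2).toNNReal) P := by
    have h := gaussianReal_const_mul (hlaw j) (a j)
    have e : NNReal.mk (a j ^ 2) (sq_nonneg _) * 1 = (a j ^ 2).toNNReal := by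
      rw [mul_one, Real.toNNReal_of_nonneg (sq_nonneg _)]
    rw [e, mul_zero] at h
    simpa only [mul_comm] using h
  have hi : iIndepFun (fun j ω => ξ j ω * a j) P :=
    hindep.comp (fun j x => x * a j) fun j => by fun_prop
  induction J using Finset.induction_on with
  | empty =>
    simp only [Finset.sum_empty, gaussianReal_zero_var]
    exact ⟨aemeasurable_const, by simp⟩
  | insert b J hb ih =>
    have h1 := hi.indepFun_finsetSum_of_notMem₀ (fun j => (hl j).aemeasurable) hb
    have e : (∑ j ∈ J, fun ω => ξ j ω * a j) = fun ω => ∑ j ∈ J, ξ j ω * a j := by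
      ext ω
      simp
    rw [e] at h1
    have h2 := gaussianReal_add_gaussianReal_of_indepFun h1 ih.map_eq (hl b).map_eq
    simp only [Finset.sum_insert hb]
    refine ⟨(hl b).aemeasurable.add ih.aemeasurable, ?_⟩
    rw [add_comm (a b ^ 2).toNNReal]
    have e2 : (fun ω => ξ b ω * a b + ∑ j ∈ J, ξ j ω * a j) =
        (fun ω => ∑ j ∈ J, ξ j ω * a j) + fun ω => ξ b ω * a b := by
      ext ω
      simp [add_comm]
    rw [e2, h2, add_zero]

/-- All moments of a Gaussian sum are determined by its variance. -/
theorem lintegral_gaussian_sum_pow (hlaw : ∀ j, HasLaw (ξ j) (gaussianReal 0 1) P)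
    (hindep : iIndepFun ξ P) (a : ℕ → ℝ) (J : Finset ℕ) (q : ℕ) :
    ∫⁻ ω, ‖∑ j ∈ J, ξ j ω * a j‖ₑ ^ (2 * q) ∂P =
      ENNReal.ofReal (∑ j ∈ J, a j ^ 2) ^ q * gaussianMoment q := by
  set v : ℝ := ∑ j ∈ J, a j ^ 2 with hv
  have hv0 : 0 ≤ v := Finset.sum_nonneg fun _ _ => sq_nonneg _
  have e : ∑ j ∈ J, (a j ^ 2).toNNReal = NNReal.mk (√v ^ 2) (sq_nonneg _) * 1 := by
    rw [mul_one, ← Real.toNNReal_sum_of_nonneg fun _ _ => sq_nonneg _,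
      Real.toNNReal_of_nonneg hv0]
    exact NNReal.eq (Real.sq_sqrt hv0).symm
  have h := hasLaw_gaussian_sum hlaw hindep a J
  have h2 := gaussianReal_map_const_mul (μ := 0) (v := 1) (√v)
  rw [e, ← mul_zero (√v), ← h2] at h
  rw [h.lintegral_comp (f := fun x => ‖x‖ₑ ^ (2 * q)) (by fun_prop),
    lintegral_map (by fun_prop) (by fun_prop)]
  simp only [enorm_mul, mul_pow]
  rw [lintegral_const_mul' _ _ (by simp), gaussianMoment]
  congr 1
  rw [pow_mul, Real.enorm_eq_ofReal (Real.sqrt_nonneg _),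
    ← ENNReal.ofReal_pow (Real.sqrt_nonneg _), Real.sq_sqrt hv0]

end GaussianSum

/-- All but one of the factors are estimated by the sup bound, the last one by the integral. -/
theorem lintegral_spectralFun_pow_le {B : ℝ} (hB : 0 ≤ B) (n q : ℕ) :
    ∫⁻ x, ENNReal.ofReal (B * spectralFun n x) ^ (q + 1) ≤
      ENNReal.ofReal (B ^ (q + 1) * √(2 * n) ^ q * n) := by
  have hK := spectralFun_nonneg n
  have h1 (x : ℝ) : ENNReal.ofReal (B * spectralFun n x) ^ (q + 1) ≤
      ENNReal.ofReal (B ^ (q + 1) * √(2 * n) ^ q * spectralFun n x) := by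
    have := hK x
    rw [← ENNReal.ofReal_pow (by positivity)]
    refine ENNReal.ofReal_le_ofReal ?_
    rw [mul_pow, mul_assoc, pow_succ (spectralFun n x)]
    have := spectralFun_le n x
    gcongr
  refine (lintegral_mono h1).trans (le_of_eq ?_)
  rw [← ofReal_integral_eq_lintegral_ofReal ((integrable_spectralFun n).const_mul _)
    (Eventually.of_forall fun x => by have := hK x; positivity), integral_const_mul,
    integral_spectralFun]

/-! ### Random Hermite sums over a block of indices -/

section Block

variable {Ω : Type*} {ξ : ℕ → Ω → ℝ} {γ : ℕ → ℝ}

/-- The `i`-th derivative of the random sum `∑_{j ∈ J} ξⱼ γⱼ φⱼ`, divided by `lⁱ`. -/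
noncomputable def scaledDeriv (ξ : ℕ → Ω → ℝ) (γ : ℕ → ℝ) (J : Finset ℕ) (l : ℝ) (i : ℕ)
    (ω : Ω) (x : ℝ) : ℝ := ∑ j ∈ J, ξ j ω * (γ j * hermiteDeriv i j x / l ^ i)

theorem gaussianDecay_scaledDeriv (J : Finset ℕ) (l : ℝ) (i : ℕ) (ω : Ω) :
    GaussianDecay (scaledDeriv ξ γ J l i ω) := by
  refine GaussianDecay.sum J fun j => ?_
  have h := (gaussianDecay_hermiteDeriv i j).const_mul (ξ j ω * γ j / l ^ i)
  have e : (fun x => ξ j ω * (γ j * hermiteDeriv i j x / l ^ i)) =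
      fun x => ξ j ω * γ j / l ^ i * hermiteDeriv i j x := by
    funext x
    ring
  rwa [e]

theorem hasDerivAt_scaledDeriv (J : Finset ℕ) {l : ℝ} (hl : l ≠ 0) (i : ℕ) (ω : Ω) (x : ℝ) :
    HasDerivAt (scaledDeriv ξ γ J l i ω) (l * scaledDeriv ξ γ J l (i + 1) ω x) x := by
  have h : HasDerivAt (scaledDeriv ξ γ J l i ω)
      (∑ j ∈ J, ξ j ω * (γ j * hermiteDeriv (i + 1) j x / l ^ i)) x :=
    HasDerivAt.fun_sum fun j _ =>
      (((hasDerivAt_hermiteDeriv i j x).const_mul (γ j)).div_const _).const_mul _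
  refine h.congr_deriv ?_
  rw [scaledDeriv, Finset.mul_sum]
  refine Finset.sum_congr rfl fun j _ => ?_
  rw [pow_succ]
  field_simp

/-- The sum of `∫ |l⁻ⁱ f⁽ⁱ⁾|^{2q}` over `i ≤ 2`, for `f = ∑_{j ∈ J} ξⱼ γⱼ φⱼ`: a Sobolev norm of order
two in which a derivative at frequency `l` has unit cost. -/
noncomputable def blockEnergy (ξ : ℕ → Ω → ℝ) (γ : ℕ → ℝ) (q : ℕ) (J : Finset ℕ) (l : ℝ)
    (ω : Ω) : ℝ≥0∞ :=
  ∑ i ∈ Finset.range 3, ∫⁻ x, ‖scaledDeriv ξ γ J l i ω x‖ₑ ^ (2 * q)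

theorem enorm_scaledDeriv_pow_le {q : ℕ} (hq : q ≠ 0) (J : Finset ℕ) {l : ℝ} (hl : 0 < l) {i : ℕ}
    (hi : i < 2) (ω : Ω) (x : ℝ) :
    ‖scaledDeriv ξ γ J l i ω x‖ₑ ^ (2 * q) ≤
      ENNReal.ofReal (2 * q * l) * blockEnergy ξ γ q J l ω := by
  refine (enorm_pow_le_lintegral hq hl (gaussianDecay_scaledDeriv J l i ω)
    ((gaussianDecay_scaledDeriv J l (i + 1) ω).const_mul l)
    (hasDerivAt_scaledDeriv J hl.ne' i ω) x).trans ?_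
  gcongr
  simp only [mul_div_cancel_left₀ _ hl.ne']
  rw [lintegral_add_left
    ((gaussianDecay_scaledDeriv J l i ω).1.measurable.enorm.pow_const _)]
  have h : ({i, i + 1} : Finset ℕ) ⊆ Finset.range 3 := by
    intro a ha
    simp at ha ⊢
    omega
  rw [blockEnergy, ← Finset.sum_pair (f := fun i => ∫⁻ x, ‖scaledDeriv ξ γ J l i ω x‖ₑ ^ (2 * q))
    (show i ≠ i + 1 by omega)]
  exact Finset.sum_le_sum_of_subset h

/-- Within the block `[n, 4n)`, `n = l²`, the variance of each rescaled derivative is bounded by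
the spectral function. -/
theorem sum_sq_hermiteDeriv_le {n : ℕ} {l D : ℝ} (hn : 1 ≤ n) (hl : l ^ 2 = n)
    {J : Finset ℕ} (hJ : J ⊆ Finset.range (4 * n)) (hγ : ∀ j ∈ J, γ j ^ 2 ≤ D) (hD : 0 ≤ D)
    {i : ℕ} (hi : i < 3) (x : ℝ) :
    ∑ j ∈ J, (γ j * hermiteDeriv i j x / l ^ i) ^ 2 ≤ 144 * D * spectralFun (6 * n) x := by
  have hn0 : (1 : ℝ) ≤ n := by exact_mod_cast hn
  have e (j : ℕ) : (γ j * hermiteDeriv i j x / l ^ i) ^ 2 =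
      γ j ^ 2 * (hermiteDeriv i j x ^ 2 / n ^ i) := by
    rw [div_pow, mul_pow, ← pow_mul, mul_comm i 2, pow_mul, hl]
    ring
  have h1 := sum_range_hermiteDeriv_sq_le i (4 * n) x
  have h2 := spectralFun_mono (show 4 * n + i ≤ 6 * n by omega) x
  have h3 := spectralFun_nonneg (6 * n) x
  have h4 : ((2 : ℝ) * (4 * n + i : ℕ)) ^ i ≤ 144 * n ^ i := by
    have h5 : ((4 * n + i : ℕ) : ℝ) ≤ 6 * n := by exact_mod_cast (by omega)
    calc ((2 : ℝ) * (4 * n + i : ℕ)) ^ i ≤ (2 * (6 * n)) ^ i := by gcongr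
      _ = 12 ^ i * n ^ i := by rw [← mul_pow]; ring
      _ ≤ 144 * n ^ i := by
        gcongr
        interval_cases i <;> norm_num
  calc ∑ j ∈ J, (γ j * hermiteDeriv i j x / l ^ i) ^ 2
      ≤ ∑ j ∈ J, D * (hermiteDeriv i j x ^ 2 / n ^ i) :=
        Finset.sum_le_sum fun j hj => by
          rw [e]
          exact mul_le_mul_of_nonneg_right (hγ j hj) (by positivity)
    _ ≤ ∑ j ∈ Finset.range (4 * n), D * (hermiteDeriv i j x ^ 2 / n ^ i) :=
        Finset.sum_le_sum_of_subset_of_nonneg hJ fun _ _ _ => by positivity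
    _ = D * ((∑ j ∈ Finset.range (4 * n), hermiteDeriv i j x ^ 2) / n ^ i) := by
        rw [← Finset.mul_sum, Finset.sum_div]
    _ ≤ D * ((144 * n ^ i * spectralFun (6 * n) x) / n ^ i) := by
        gcongr
        refine h1.trans ?_
        have := spectralFun_nonneg (4 * n + i) x
        gcongr
    _ = _ := by
        field_simp

variable [MeasurableSpace Ω] {P : Measure Ω}

theorem aemeasurable_uncurry_scaledDeriv (hξ : ∀ j, AEMeasurable (ξ j) P) (q : ℕ) (J : Finset ℕ)
    (l : ℝ) (i : ℕ) :
    AEMeasurable (Function.uncurry fun ω x => ‖scaledDeriv ξ γ J l i ω x‖ₑ ^ (2 * q))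
      (P.prod volume) := by
  have h : AEMeasurable (fun p : Ω × ℝ => scaledDeriv ξ γ J l i p.1 p.2) (P.prod volume) := by
    unfold scaledDeriv
    refine Finset.aemeasurable_fun_sum J fun j _ => ?_
    have h1 : AEMeasurable (fun p : Ω × ℝ => ξ j p.1) (P.prod volume) := (hξ j).comp_fst
    have h2 : Measurable (fun p : Ω × ℝ => hermiteDeriv i j p.2) :=
      (gaussianDecay_hermiteDeriv i j).1.measurable.comp measurable_snd
    exact h1.mul ((h2.const_mul (γ j)).div_const _).aemeasurable
  exact h.enorm.pow_const _

theorem aemeasurable_blockEnergy (hξ : ∀ j, AEMeasurable (ξ j) P) (q : ℕ) (J : Finset ℕ) (l : ℝ) :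
    AEMeasurable (blockEnergy ξ γ q J l) P :=
  Finset.aemeasurable_fun_sum _ fun i _ =>
    (aemeasurable_uncurry_scaledDeriv hξ q J l i).lintegral_prod_right'

theorem lintegral_blockEnergy_le [IsProbabilityMeasure P]
    (hlaw : ∀ j, HasLaw (ξ j) (gaussianReal 0 1) P)
    (hindep : iIndepFun ξ P) (q : ℕ) {n : ℕ} {l D : ℝ} (hn : 1 ≤ n) (hl : l ^ 2 = n)
    {J : Finset ℕ} (hJ : J ⊆ Finset.range (4 * n)) (hγ : ∀ j ∈ J, γ j ^ 2 ≤ D) (hD : 0 ≤ D) :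
    ∫⁻ ω, blockEnergy ξ γ (q + 1) J l ω ∂P ≤
      3 * (ENNReal.ofReal ((144 * D) ^ (q + 1) * √(2 * (6 * n : ℕ)) ^ q * (6 * n : ℕ)) *
        gaussianMoment (q + 1)) := by
  have hξ (j : ℕ) := (hlaw j).aemeasurable
  unfold blockEnergy
  rw [lintegral_finsetSum' (f := fun i ω => ∫⁻ x, ‖scaledDeriv ξ γ J l i ω x‖ₑ ^ (2 * (q + 1))) _
    fun i _ => (aemeasurable_uncurry_scaledDeriv hξ (q + 1) J l i).lintegral_prod_right']
  refine (Finset.sum_le_card_nsmul _ _ _ fun i hi => ?_).trans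
    (le_of_eq (by rw [Finset.card_range, nsmul_eq_mul]; rfl))
  rw [lintegral_lintegral_swap (aemeasurable_uncurry_scaledDeriv hξ (q + 1) J l i)]
  simp only [scaledDeriv, lintegral_gaussian_sum_pow hlaw hindep]
  rw [lintegral_mul_const' _ _ (gaussianMoment_lt_top _).ne]
  gcongr
  refine le_trans (lintegral_mono fun x => ?_)
    (lintegral_spectralFun_pow_le (B := 144 * D) (by positivity) (6 * n) q)
  gcongr
  exact sum_sq_hermiteDeriv_le hn hl hJ hγ hD (Finset.mem_range.1 hi) x

end Block

/-! ### Summation over the blocks -/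

/-- The weight `2^{k(3 + 16β)}` of the `k`-th block. It contains the factor `2ᵏ` lost in the Sobolev
inequality, the factor `2^{16kβ}` lost in the interpolation to Hölder norms, and a gain of `4ᵏ`. -/
noncomputable def blockWeight (β : ℝ≥0) (k : ℕ) : ℝ :=
  ((2 : ℝ) ^ k) ^ 3 * (((2 : ℝ) ^ k) ^ (β : ℝ)) ^ 16

theorem blockWeight_nonneg (β : ℝ≥0) (k : ℕ) : 0 ≤ blockWeight β k := by
  unfold blockWeight
  positivity

/-- The bookkeeping of exponents: the number of partial sums in the `k`-th block, its weight and the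
bound for the expected energy multiply to a constant times `2^{k(14 + 16β - 32s)}`, and
`β < 2s - 1` makes this exponent at most `-2k`. -/
theorem blockWeight_mul_le {β : ℝ≥0} {s : ℝ} (hβ : (β : ℝ) < 2 * s - 1) (C : ℝ) (k : ℕ) :
    (4 * 4 ^ k : ℕ) * (blockWeight β k * (3 * ((144 * (C * ((4 : ℝ) ^ k) ^ (-s)) ^ 2) ^ 8 *
      √(2 * (6 * 4 ^ k : ℕ)) ^ 7 * (6 * 4 ^ k : ℕ)))) ≤
      (72 * (144 * C ^ 2) ^ 8 * √12 ^ 7) * (1 / 4) ^ k := by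
  set l : ℝ := 2 ^ k with hl
  have hl0 : 0 < l := by positivity
  have hl1 : 1 ≤ l := one_le_pow₀ (by norm_num)
  have h4 : (4 : ℝ) ^ k = l ^ 2 := by
    rw [hl, ← pow_mul, mul_comm k 2, pow_mul]
    norm_num
  have h4' : (1 / 4 : ℝ) ^ k = l ^ (-2 : ℝ) := by
    rw [Real.rpow_neg hl0.le, one_div, inv_pow, h4, Real.rpow_two]
  have hsq : √(2 * (6 * 4 ^ k : ℕ) : ℝ) = √12 * l := by
    push_cast
    rw [h4, show (2 : ℝ) * (6 * l ^ 2) = 12 * l ^ 2 by ring, Real.sqrt_mul (by norm_num),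
      Real.sqrt_sq hl0.le]
  have e1 : (l ^ 2) ^ (-s) = l ^ (-2 * s) := by
    rw [← Real.rpow_natCast l 2, ← Real.rpow_mul hl0.le]
    push_cast
    ring_nf
  have e2 : l ^ 14 * (l ^ (β : ℝ)) ^ 16 * (l ^ (-2 * s)) ^ 16 ≤ l ^ (-2 : ℝ) := by
    rw [← Real.rpow_natCast, ← Real.rpow_natCast, ← Real.rpow_natCast, ← Real.rpow_mul hl0.le,
      ← Real.rpow_mul hl0.le, ← Real.rpow_add hl0, ← Real.rpow_add hl0]
    refine Real.rpow_le_rpow_of_exponent_le hl1 ?_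
    push_cast
    linarith
  rw [blockWeight, hsq, h4, e1, h4']
  push_cast
  rw [h4]
  calc _ = (72 * (144 * C ^ 2) ^ 8 * √12 ^ 7) *
        (l ^ 14 * (l ^ (β : ℝ)) ^ 16 * (l ^ (-2 * s)) ^ 16) := by ring
    _ ≤ _ := mul_le_mul_of_nonneg_left e2 (by positivity)

section Summation

variable {Ω : Type*} {ξ : ℕ → Ω → ℝ} {γ : ℕ → ℝ} {β : ℝ≥0}

/-- The weighted sum of the energies of all partial sums over initial segments of the blocks
`[4ᵏ, 4ᵏ⁺¹)`, with scale `l = 2ᵏ` in the `k`-th block. -/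
noncomputable def totalEnergy (ξ : ℕ → Ω → ℝ) (γ : ℕ → ℝ) (β : ℝ≥0) (ω : Ω) : ℝ≥0∞ :=
  ∑' k : ℕ, ∑ N ∈ Finset.Icc (4 ^ k) (4 ^ (k + 1)),
    ENNReal.ofReal (blockWeight β k) * blockEnergy ξ γ 8 (Finset.Ico (4 ^ k) N) (2 ^ k) ω

/-- Where the total energy is finite, the partial sums over the blocks decay geometrically: the
weight of the block pays for the Sobolev inequality and for the interpolation, and its spare factor
`4ᵏ` gives the rate after a sixteenth root. -/
theorem holderBound_block {ω : Ω} (hβ : β ≤ 1) (hZ : totalEnergy ξ γ β ω < ∞) (k N : ℕ)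
    (h1 : 4 ^ k ≤ N) (h2 : N ≤ 4 ^ (k + 1)) :
    HolderBound β (fun x => ∑ j ∈ Finset.Ico (4 ^ k) N, ξ j ω * γ j * hermiteFun j x)
      (2 * (16 * (totalEnergy ξ γ β ω).toReal) ^ (1 / 16 : ℝ) *
        ((1 / 4 : ℝ) ^ (1 / 16 : ℝ)) ^ k) := by
  set Z := totalEnergy ξ γ β ω with hZdef
  set l : ℝ := 2 ^ k with hl
  set J := Finset.Ico (4 ^ k) N
  set T : ℝ := (16 * Z.toReal) ^ (1 / 16 : ℝ) with hT
  set r : ℝ := (1 / 4 : ℝ) ^ (1 / 16 : ℝ) with hr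
  have hl0 : 0 < l := by positivity
  have hT16 : T ^ 16 = 16 * Z.toReal := by
    rw [hT, ← Real.rpow_natCast, ← Real.rpow_mul (by positivity)]
    norm_num
  have hr16 : r ^ 16 = 1 / 4 := by
    rw [hr, ← Real.rpow_natCast, ← Real.rpow_mul (by positivity)]
    norm_num
  have hlk : l ^ 2 * (1 / 4) ^ k = 1 := by
    rw [hl, ← pow_mul, mul_comm k 2, pow_mul, ← mul_pow]
    norm_num
  have hlβ : 0 < l ^ (β : ℝ) := Real.rpow_pos_of_pos hl0 _
  have hle : ENNReal.ofReal (blockWeight β k) * blockEnergy ξ γ 8 J l ω ≤ Z := by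
    refine le_trans ?_ (ENNReal.le_tsum k)
    exact Finset.single_le_sum (f := fun N => ENNReal.ofReal (blockWeight β k) *
      blockEnergy ξ γ 8 (Finset.Ico (4 ^ k) N) (2 ^ k) ω) (fun _ _ => zero_le)
      (Finset.mem_Icc.2 ⟨h1, h2⟩)
  have hsup {i : ℕ} (hi : i < 2) (x : ℝ) :
      |scaledDeriv ξ γ J l i ω x| ≤ T * r ^ k / l ^ (β : ℝ) := by
    have h := enorm_scaledDeriv_pow_le (ξ := ξ) (γ := γ) (q := 8) (by norm_num) J hl0 hi ω x
    have h3 : ENNReal.ofReal (l ^ 2 * (l ^ (β : ℝ)) ^ 16) *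
        ‖scaledDeriv ξ γ J l i ω x‖ₑ ^ (2 * 8) ≤ ENNReal.ofReal (16 * Z.toReal) := by
      calc _ ≤ ENNReal.ofReal (l ^ 2 * (l ^ (β : ℝ)) ^ 16) *
            (ENNReal.ofReal (2 * (8 : ℕ) * l) * blockEnergy ξ γ 8 J l ω) := by gcongr
        _ = ENNReal.ofReal 16 *
            (ENNReal.ofReal (blockWeight β k) * blockEnergy ξ γ 8 J l ω) := by
          rw [← mul_assoc, ← mul_assoc, ← ENNReal.ofReal_mul (by positivity),
            ← ENNReal.ofReal_mul (by positivity)]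
          congr 2
          rw [blockWeight, ← hl]
          push_cast
          ring
        _ ≤ ENNReal.ofReal 16 * Z := by gcongr
        _ = _ := by
          rw [ENNReal.ofReal_mul (by norm_num), ENNReal.ofReal_toReal hZ.ne]
    rw [← ofReal_norm, ← ENNReal.ofReal_pow (norm_nonneg _),
      ← ENNReal.ofReal_mul (by positivity), ENNReal.ofReal_le_ofReal_iff (by positivity),
      Real.norm_eq_abs, ← hT16] at h3
    rw [le_div_iff₀ hlβ]
    refine le_of_pow_le_pow_left₀ (n := 16) (by norm_num) (by positivity) ?_
    have h4 : (r ^ k) ^ 16 = (1 / 4) ^ k := by rw [← pow_mul, mul_comm, pow_mul, hr16]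
    have h5 : (0 : ℝ) < (1 / 4) ^ k := by positivity
    rw [mul_pow, mul_pow, h4]
    calc |scaledDeriv ξ γ J l i ω x| ^ 16 * (l ^ (β : ℝ)) ^ 16
        = (l ^ 2 * (l ^ (β : ℝ)) ^ 16 * |scaledDeriv ξ γ J l i ω x| ^ (2 * 8)) * (1 / 4) ^ k := by
          linear_combination (-(|scaledDeriv ξ γ J l i ω x| ^ 16 * (l ^ (β : ℝ)) ^ 16)) * hlk
      _ ≤ T ^ 16 * (1 / 4) ^ k := by gcongr
  have h := HolderBound.of_deriv_le hβ (one_le_pow₀ (by norm_num) : 1 ≤ l)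
    (hasDerivAt_scaledDeriv J hl0.ne' 0 ω) (hsup (i := 0) (by norm_num)) (fun x => by
      rw [abs_mul, abs_of_pos hl0]
      exact mul_le_mul_of_nonneg_left (hsup (by norm_num) x) hl0.le)
  refine (h.mono (le_of_eq ?_)).congr fun x => ?_
  · rw [← hl]
    field_simp
  · simp [scaledDeriv, hermiteDeriv_zero, mul_assoc]

variable [MeasurableSpace Ω] {P : Measure Ω} [IsProbabilityMeasure P]

theorem ae_totalEnergy_lt_top (hlaw : ∀ j, HasLaw (ξ j) (gaussianReal 0 1) P)
    (hindep : iIndepFun ξ P) {s C : ℝ} (hβ : (β : ℝ) < 2 * s - 1)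
    (hγ : ∀ j : ℕ, j ≠ 0 → |γ j| ≤ C * (j : ℝ) ^ (-s)) :
    ∀ᵐ ω ∂P, totalEnergy ξ γ β ω < ∞ := by
  have hξ (j : ℕ) := (hlaw j).aemeasurable
  have hs : 0 ≤ s := by
    have : 0 ≤ (β : ℝ) := β.coe_nonneg
    linarith
  have hC : 0 ≤ C := by simpa using (abs_nonneg _).trans (hγ 1 one_ne_zero)
  have hmeas (k N : ℕ) : AEMeasurable (fun ω => ENNReal.ofReal (blockWeight β k) *
      blockEnergy ξ γ 8 (Finset.Ico (4 ^ k) N) (2 ^ k) ω) P :=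
    (aemeasurable_blockEnergy hξ 8 _ _).const_mul _
  have hmeas' (k : ℕ) : AEMeasurable (fun ω => ∑ N ∈ Finset.Icc (4 ^ k) (4 ^ (k + 1)),
      ENNReal.ofReal (blockWeight β k) *
        blockEnergy ξ γ 8 (Finset.Ico (4 ^ k) N) (2 ^ k) ω) P :=
    Finset.aemeasurable_fun_sum _ fun N _ => hmeas k N
  set K : ℝ := 72 * (144 * C ^ 2) ^ 8 * √12 ^ 7 with hK
  have hK0 : 0 ≤ K := by positivity
  have hblock (k : ℕ) : ∫⁻ ω, ∑ N ∈ Finset.Icc (4 ^ k) (4 ^ (k + 1)),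
      ENNReal.ofReal (blockWeight β k) *
        blockEnergy ξ γ 8 (Finset.Ico (4 ^ k) N) (2 ^ k) ω ∂P ≤
      ENNReal.ofReal (K * (1 / 4) ^ k) * gaussianMoment 8 := by
    set E : ℝ := (144 * (C * ((4 : ℝ) ^ k) ^ (-s)) ^ 2) ^ 8 * √(2 * (6 * 4 ^ k : ℕ)) ^ 7 *
      (6 * 4 ^ k : ℕ) with hE
    have hE0 : 0 ≤ E := by positivity
    have hw := blockWeight_nonneg β k
    rw [lintegral_finsetSum' _ fun N _ => hmeas k N]
    have hterm (N : ℕ) (hN : N ∈ Finset.Icc (4 ^ k) (4 ^ (k + 1))) :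
        ∫⁻ ω, ENNReal.ofReal (blockWeight β k) *
          blockEnergy ξ γ 8 (Finset.Ico (4 ^ k) N) (2 ^ k) ω ∂P ≤
        ENNReal.ofReal (blockWeight β k * (3 * E)) * gaussianMoment 8 := by
      rw [lintegral_const_mul' _ _ ENNReal.ofReal_ne_top]
      have h : ∫⁻ ω, blockEnergy ξ γ 8 (Finset.Ico (4 ^ k) N) (2 ^ k) ω ∂P ≤
          3 * (ENNReal.ofReal E * gaussianMoment 8) :=
        lintegral_blockEnergy_le (γ := γ) hlaw hindep 7 (n := 4 ^ k) (l := 2 ^ k)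
        (D := (C * ((4 : ℝ) ^ k) ^ (-s)) ^ 2) (J := Finset.Ico (4 ^ k) N)
        (Nat.one_le_pow _ _ (by norm_num))
        (by rw [← pow_mul, mul_comm k 2, pow_mul]; norm_num)
        (fun j hj => by
          have := (Finset.mem_Ico.1 hj).2
          have := (Finset.mem_Icc.1 hN).2
          rw [pow_succ] at this
          exact Finset.mem_range.2 (by omega))
        (fun j hj => by
          have hj1 := (Finset.mem_Ico.1 hj).1
          have hpos : 0 < 4 ^ k := by positivity
          rw [← sq_abs]
          have hj2 : (j : ℝ) ^ (-s) ≤ ((4 : ℝ) ^ k) ^ (-s) :=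
            Real.rpow_le_rpow_of_nonpos (by positivity) (by exact_mod_cast hj1) (by linarith)
          have := hγ j (by omega)
          gcongr
          exact this.trans (by gcongr))
        (sq_nonneg _)
      calc _ ≤ ENNReal.ofReal (blockWeight β k) *
            (3 * (ENNReal.ofReal E * gaussianMoment 8)) := by gcongr
        _ = _ := by
          rw [ENNReal.ofReal_mul hw, ENNReal.ofReal_mul (p := 3) (by norm_num),
            ENNReal.ofReal_ofNat]
          ring
    refine (Finset.sum_le_card_nsmul _ _ _ hterm).trans ?_
    have hcard : (Finset.Icc (4 ^ k) (4 ^ (k + 1))).card ≤ 4 * 4 ^ k := by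
      have hpos : 0 < 4 ^ k := by positivity
      rw [Nat.card_Icc, pow_succ]
      omega
    calc _ ≤ ((4 * 4 ^ k : ℕ) : ℝ≥0∞) *
          (ENNReal.ofReal (blockWeight β k * (3 * E)) * gaussianMoment 8) := by
          rw [nsmul_eq_mul]
          gcongr
      _ = ENNReal.ofReal ((4 * 4 ^ k : ℕ) * (blockWeight β k * (3 * E))) * gaussianMoment 8 := by
          rw [ENNReal.ofReal_mul (p := ((4 * 4 ^ k : ℕ) : ℝ)) (by positivity),
            ENNReal.ofReal_natCast, mul_assoc]
      _ ≤ _ := by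
          refine mul_le_mul_left (ENNReal.ofReal_le_ofReal ?_) _
          exact blockWeight_mul_le hβ C k
  refine ae_lt_top' (AEMeasurable.tsum hmeas') ?_
  unfold totalEnergy
  rw [lintegral_tsum hmeas']
  refine ne_top_of_le_ne_top ?_ (ENNReal.tsum_le_tsum hblock)
  rw [ENNReal.tsum_mul_right, ← ENNReal.ofReal_tsum_of_nonneg (fun k => by positivity)
    ((summable_geometric_of_lt_one (by norm_num) (by norm_num)).mul_left K)]
  exact ENNReal.mul_ne_top ENNReal.ofReal_ne_top (gaussianMoment_lt_top 8).ne

end Summation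

theorem exists_holderBound_sum {β : ℝ≥0} (hβ : β ≤ 1) (c : ℕ → ℝ) (N : ℕ) :
    ∃ A, HolderBound β (fun x => ∑ j ∈ Finset.range N, c j * hermiteFun j x) A := by
  obtain ⟨A, -, hA⟩ := (GaussianDecay.sum (Finset.range N)
    fun j => (gaussianDecay_hermiteDeriv 0 j).const_mul (c j)).exists_bound
  obtain ⟨B, -, hB⟩ := (GaussianDecay.sum (Finset.range N)
    fun j => (gaussianDecay_hermiteDeriv 1 j).const_mul (c j)).exists_bound
  refine ⟨_, HolderBound.of_deriv_le (s := max A B) (l := 1) hβ le_rfl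
    (fun x => HasDerivAt.fun_sum fun j _ => (hasDerivAt_hermiteDeriv 0 j x).const_mul (c j))
    (fun x => (hA x).trans (le_max_left _ _)) fun x => ?_⟩
  rw [one_mul]
  exact (hB x).trans (le_max_right _ _)

theorem mainTheorem11 {Ω : Type*} [MeasurableSpace Ω] (P : Measure Ω) [IsProbabilityMeasure P]
    (s : ℝ) (hs : 1 / 2 < s)
    (γ : ℕ → ℝ) (hγ : γ =O[atTop] (fun j : ℕ => (j : ℝ) ^ (-s)))
    (ξ : ℕ → Ω → ℝ) (hlaw : ∀ j, HasLaw (ξ j) (gaussianReal 0 1) P) (hindep : iIndepFun ξ P)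
    (β : ℝ≥0) (hβ0 : 0 < β) (hβ : (β : ℝ) < (4 * s - 2) / (4 * s + 1)) :
    ∀ᵐ ω ∂P, ConvergesInC0Holder β
      (fun N x => ∑ j ∈ Finset.range N, ξ j ω * γ j * hermiteFun j x) := by
  obtain ⟨C, -, hC⟩ := Asymptotics.bound_of_isBigO_nat_atTop hγ
  have hγ' (j : ℕ) (hj : j ≠ 0) : |γ j| ≤ C * (j : ℝ) ^ (-s) := by
    have hpos : 0 < (j : ℝ) ^ (-s) := Real.rpow_pos_of_pos (by positivity) _
    have h := hC hpos.ne'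
    rwa [Real.norm_eq_abs, Real.norm_of_nonneg hpos.le] at h
  have hs4 : 0 < 4 * s + 1 := by linarith
  rw [lt_div_iff₀ hs4] at hβ
  have hβ' : 0 ≤ (β : ℝ) := β.coe_nonneg
  have hβ1 : β ≤ 1 := by
    have : (β : ℝ) ≤ 1 := by nlinarith
    exact_mod_cast this
  have hβ2 : (β : ℝ) < 2 * s - 1 := by nlinarith
  filter_upwards [ae_totalEnergy_lt_top hlaw hindep hβ2 hγ'] with ω hω
  refine convergesInC0Holder_of_geometric (r := (1 / 4 : ℝ) ^ (1 / 16 : ℝ)) (by positivity)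
    (Real.rpow_lt_one (by norm_num) (by norm_num) (by norm_num))
    (exists_holderBound_sum hβ1 fun j => ξ j ω * γ j) fun k N h1 h2 =>
      (holderBound_block hβ1 hω k N h1 h2).congr fun x => ?_
  rw [Finset.sum_Ico_eq_sub _ h1]
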